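/- A smooth curve is a $C^\infty$ map $\gamma:[a,b]\to\mathbf R^n$ ($a<b$) with $\gamma'\neq0$ everywhere; write $\partial_s\psi=\psi_s=\psi'/|\gamma'|$ for the arclength derivative along $\gamma$. The curve is called an elastica if there is $\lambda\in\mathbf R$ such that on $[a,b]$ $$2\gamma_{ssss}+6\langle\gamma_{ss},\gamma_{sss}\rangle\gamma_s+3|\gamma_{ss}|^2\gamma_{ss}-\lambda\gamma_{ss}=0.$$ For $m\in[0,1)$ and $x\in\mathbf R$ let $F(x,m)=\int_0^x\frac{d\theta}{\sqrt{1-m\sin^2\theta}}$ and $E(x,m)=\int_0^x\sqrt{1-m\sin^2\theta}\,d\theta$, let $\operatorname{am}(\cdot,m)$ be the inverse function of $F(\cdot,m):\mathbf R\to\mathbf R$, and put $\operatorname{sn}(x,m)=\sin\operatorname{am}(x,m)$, $\operatorname{cn}(x,m)=\cos\operatorname{am}(x,m)$, $\operatorname{dn}(x,m)=\sqrt{1-m\sin^2\operatorname{am}(x,m)}$. Let $\operatorname{sech}x=1/\cosh x$. **Theorem 2.11 (Explicit parametrizations of planar elasticae).** Let $L>0$ and let $\gamma:[0,L]\to\mathbf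 R^2$ be an arclength parametrized elastica. Then, up to similarity (translation, rotation, reflection and dilation), $\gamma$ is represented by $\gamma(s)=\gamma_*(s+s_0)$ for some $s_0\in\mathbf R$; precisely, there are $s_0\in\mathbf R$, $\Lambda>0$, $A\in O(2)$ and $b\in\mathbf R^2$ such that $$\gamma(s)=b+\Lambda A\,\gamma_*\!\left(\tfrac{s}{\Lambda}+s_0\right)\qquad\text{for all } s\in[0,L],$$ where $\gamma_*:\mathbf R\to\mathbf R^2$ is one of the following curves: - (Case I, linear elastica) $\gamma_\ell(s)=(s,\,0)$; - (Case II, wavelike elastica) for some $m\in(0,1)$, $\gamma_w(s,m)=\big(2E(\operatorname{am}(s,m),m)-s,\ -2\sqrt m\,\operatorname{cn}(s,m)\big)$; - (Case III, borderline elastica) $\gamma_b(s)=\big(2\tanh s-s,\ -2\operatorname{sech}s\big)$; - (Case IV, orbitlike elastica) for some $m\in(0,1)$, $\gamma_o(s,m)=\frac1m\big(2E(\operatorname{am}(s,m),m)+(m-2)s,\ -2\operatorname{dn}(s,m)\big)$; - (Case V, circular elastica) $\gamma_c(s)=(\sin s,\,-\cos s)$. Moreover, each of these curves (in Cases II and IV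 for every $m\in(0,1)$) is smooth and arclength parametrized on $\mathbf R$, has the continuous function $\theta_*$ below as a tangential angle, i.e. $\partial_s\gamma_*=(\cos\theta_*,\sin\theta_*)$, and has the signed curvature $k_*$ below, where the signed curvature is $\langle\partial_s^2\gamma_*,N\rangle$ with $N$ the counterclockwise rotation of $\partial_s\gamma_*$ through $\pi/2$: - (I) $\theta_\ell(s)=0$, $k_\ell(s)=0$; - (II) $\theta_w(s)=2\arcsin(\sqrt m\,\operatorname{sn}(s,m))$, $k_w(s)=2\sqrt m\,\operatorname{cn}(s,m)$; - (III) $\theta_b(s)=2\arcsin(\tanh s)$, $k_b(s)=2\operatorname{sech}s$; - (IV) $\theta_o(s)=2\operatorname{am}(s,m)$, $k_o(s)=2\operatorname{dn}(s,m)$; - (V) $\theta_c(s)=s$, $k_c(s)=1$. -/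

import Mathlib

open scoped ContDiff

namespace Elastica

noncomputable section

/-! ## Curves in Euclidean space, arclength derivatives, elasticae -/

/-- The arclength derivative `∂_s ψ = ψ' / |γ'|` along the curve `γ`, both defined on the
set `S ⊆ ℝ` (a closed interval, or the whole line). -/
def arcDeriv {n d : ℕ} (S : Set ℝ) (γ : ℝ → EuclideanSpace ℝ (Fin n))
    (ψ : ℝ → EuclideanSpace ℝ (Fin d)) (x : ℝ) : EuclideanSpace ℝ (Fin d) :=
  ‖derivWithin γ S x‖⁻¹ • derivWithin ψ S x

/-- A smooth curve on `S`: a map of class `C^∞` with nowhere vanishing derivative. -/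
def IsSmoothCurve {n : ℕ} (S : Set ℝ) (γ : ℝ → EuclideanSpace ℝ (Fin n)) : Prop :=
  ContDiffOn ℝ ∞ γ S ∧ ∀ x ∈ S, derivWithin γ S x ≠ 0

/-- `γ` is a smooth curve on `S` with unit speed. -/
def IsArclengthParametrized {n : ℕ} (S : Set ℝ) (γ : ℝ → EuclideanSpace ℝ (Fin n)) : Prop :=
  IsSmoothCurve S γ ∧ ∀ x ∈ S, ‖derivWithin γ S x‖ = 1

/-- The iterated arclength derivative `∂_s^j γ`. -/
def arcDerivIter {n : ℕ} (S : Set ℝ) (γ : ℝ → EuclideanSpace ℝ (Fin n)) (j : ℕ) :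
    ℝ → EuclideanSpace ℝ (Fin n) :=
  (arcDeriv S γ)^[j] γ

/-- A smooth curve `γ : [a, b] → ℝⁿ` is a `lam`-elastica if
`2 γ_ssss + 6 ⟨γ_ss, γ_sss⟩ γ_s + 3 |γ_ss|² γ_ss - lam γ_ss = 0` on `[a, b]`. -/
def IsElasticaWith {n : ℕ} (lam a b : ℝ) (γ : ℝ → EuclideanSpace ℝ (Fin n)) : Prop :=
  IsSmoothCurve (Set.Icc a b) γ ∧ ∀ x ∈ Set.Icc a b,
    (2 : ℝ) • arcDerivIter (Set.Icc a b) γ 4 x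
      + (6 * inner ℝ (arcDerivIter (Set.Icc a b) γ 2 x) (arcDerivIter (Set.Icc a b) γ 3 x)) •
          arcDerivIter (Set.Icc a b) γ 1 x
      + (3 * ‖arcDerivIter (Set.Icc a b) γ 2 x‖ ^ 2) • arcDerivIter (Set.Icc a b) γ 2 x
      - lam • arcDerivIter (Set.Icc a b) γ 2 x = 0

/-- A smooth curve `γ : [a, b] → ℝⁿ` is an elastica if it is a `lam`-elastica for some real
multiplier `lam`. -/
def IsElastica {n : ℕ} (a b : ℝ) (γ : ℝ → EuclideanSpace ℝ (Fin n)) : Prop :=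
  ∃ lam : ℝ, IsElasticaWith lam a b γ

/-! ## Planar curves: tangential angle, signed curvature, similarity -/

/-- Counterclockwise rotation of the plane through the angle `π / 2`. -/
def rotHalfPi (v : EuclideanSpace ℝ (Fin 2)) : EuclideanSpace ℝ (Fin 2) :=
  !₂[-(v 1), v 0]

/-- `θ` is a tangential angle function of the planar curve `γ` on `S`: it is continuous and
`∂_s γ = (cos θ, sin θ)`. -/
def IsTangentialAngle (S : Set ℝ) (γ : ℝ → EuclideanSpace ℝ (Fin 2)) (θ : ℝ → ℝ) : Prop :=
  ContinuousOn θ S ∧ ∀ s ∈ S, arcDerivIter S γ 1 s = !₂[Real.cos (θ s), Real.sin (θ s)]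

/-- The signed curvature `k = ⟨γ_ss, N⟩`, where `N` is the tangent `γ_s` rotated by `π / 2`. -/
def signedCurvature (S : Set ℝ) (γ : ℝ → EuclideanSpace ℝ (Fin 2)) (s : ℝ) : ℝ :=
  inner ℝ (arcDerivIter S γ 2 s) (rotHalfPi (arcDerivIter S γ 1 s))

/-- `γ : ℝ → ℝ²` is parametrized by arclength, `θ` is a tangential angle function of `γ`, and
`k` is the signed curvature of `γ`. -/
def IsArclengthCurveWith (γ : ℝ → EuclideanSpace ℝ (Fin 2)) (θ k : ℝ → ℝ) : Prop :=
  IsArclengthParametrized Set.univ γ ∧ IsTangentialAngle Set.univ γ θ ∧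
    ∀ s, signedCurvature Set.univ γ s = k s

/-- On `[0, L]`, the arclength parametrized curve `γ` is represented, up to similarity, by
`s ↦ γstar (s + s₀)` for some `s₀`. The similarity is `p ↦ b + Λ • A p` with `Λ > 0`, `A`
orthogonal (a rotation or a reflection) and `b` a translation vector; a dilation by the factor
`Λ` turns an arclength parameter `s / Λ` into the arclength parameter `s`. -/
def RepresentedUpToSimilarity (L : ℝ) (γ γstar : ℝ → EuclideanSpace ℝ (Fin 2)) : Prop :=
  ∃ (Λ : ℝ) (A : EuclideanSpace ℝ (Fin 2) ≃ₗᵢ[ℝ] EuclideanSpace ℝ (Fin 2))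
    (b : EuclideanSpace ℝ (Fin 2)) (s₀ : ℝ), 0 < Λ ∧
      ∀ s ∈ Set.Icc 0 L, γ s = b + Λ • A (γstar (s / Λ + s₀))

/-! ## Jacobi elliptic integrals and functions, with parameter `m ∈ [0, 1)` -/

/-- Incomplete elliptic integral of the first kind. -/
def ellipticF (x m : ℝ) : ℝ :=
  ∫ θ in (0 : ℝ)..x, 1 / Real.sqrt (1 - m * Real.sin θ ^ 2)

/-- Incomplete elliptic integral of the second kind. -/
def ellipticE (x m : ℝ) : ℝ :=
  ∫ θ in (0 : ℝ)..x, Real.sqrt (1 - m * Real.sin θ ^ 2)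

/-- The Jacobi amplitude: the inverse function of `F(·, m)`, which is a bijection of `ℝ` for
`m ∈ [0, 1)`; see `ellipticF_bijective`. -/
def am (x m : ℝ) : ℝ :=
  Function.invFun (fun y => ellipticF y m) x

theorem ellipticF_bijective {m : ℝ} (h0 : 0 ≤ m) (h1 : m < 1) :
    Function.Bijective (fun y => ellipticF y m) := by
  have hpos : ∀ θ : ℝ, 0 < 1 - m * Real.sin θ ^ 2 := fun θ => by
    nlinarith [Real.sin_sq_le_one θ, sq_nonneg (Real.sin θ)]
  have hc : Continuous (fun θ : ℝ => 1 / Real.sqrt (1 - m * Real.sin θ ^ 2)) := by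
    refine continuous_const.div (by fun_prop) fun θ => (Real.sqrt_pos.2 (hpos θ)).ne'
  have hd : ∀ y, HasDerivAt (fun y => ellipticF y m)
      (1 / Real.sqrt (1 - m * Real.sin y ^ 2)) y := fun y =>
    intervalIntegral.integral_hasDerivAt_right (hc.intervalIntegrable _ _)
      hc.stronglyMeasurable.stronglyMeasurableAtFilter hc.continuousAt
  have hge : ∀ y : ℝ, 1 ≤ 1 / Real.sqrt (1 - m * Real.sin y ^ 2) := fun y => by
    rw [le_div_iff₀ (Real.sqrt_pos.2 (hpos y)), one_mul, Real.sqrt_le_iff]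
    constructor <;> nlinarith [mul_nonneg h0 (sq_nonneg (Real.sin y))]
  have hmono : Monotone (fun y => ellipticF y m - y) :=
    monotone_of_hasDerivAt_nonneg (fun y => (hd y).sub (hasDerivAt_id y))
      (fun y => by have := hge y; simpa using this)
  have hzero : ellipticF 0 m = 0 := by simp [ellipticF]
  have hcont : Continuous (fun y => ellipticF y m) :=
    continuous_iff_continuousAt.2 fun y => (hd y).continuousAt
  refine ⟨StrictMono.injective fun x y hxy => ?_, hcont.surjective ?_ ?_⟩
  · have := hmono hxy.le
    simp only at this ⊢
    linarith
  · refine Filter.tendsto_atTop_mono' _ ?_ Filter.tendsto_id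
    filter_upwards [Filter.eventually_ge_atTop 0] with y hy
    have := hmono hy
    simp only [hzero] at this
    simp only [id]
    linarith
  · refine Filter.tendsto_atBot_mono' _ ?_ Filter.tendsto_id
    filter_upwards [Filter.eventually_le_atBot 0] with y hy
    have := hmono hy
    simp only [hzero] at this
    simp only [id]
    linarith

/-- Elliptic sine, for `m ∈ [0, 1)`. -/
def sn (x m : ℝ) : ℝ := Real.sin (am x m)

/-- Elliptic cosine, for `m ∈ [0, 1)`. -/
def cn (x m : ℝ) : ℝ := Real.cos (am x m)

/-- Elliptic delta, for `m ∈ [0, 1)`. -/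
def dn (x m : ℝ) : ℝ := Real.sqrt (1 - m * Real.sin (am x m) ^ 2)

/-- Hyperbolic secant. -/
def sech (x : ℝ) : ℝ := 1 / Real.cosh x

/-! ## The five model curves -/

/-- Linear elastica. -/
def linearCurve (s : ℝ) : EuclideanSpace ℝ (Fin 2) := !₂[s, 0]

/-- Wavelike elastica with parameter `m ∈ (0, 1)`. -/
def wavelikeCurve (m s : ℝ) : EuclideanSpace ℝ (Fin 2) :=
  !₂[2 * ellipticE (am s m) m - s, -2 * Real.sqrt m * cn s m]

/-- Borderline elastica. -/
def borderlineCurve (s : ℝ) : EuclideanSpace ℝ (Fin 2) :=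
  !₂[2 * Real.tanh s - s, -2 * sech s]

/-- Orbitlike elastica with parameter `m ∈ (0, 1)`. -/
def orbitlikeCurve (m s : ℝ) : EuclideanSpace ℝ (Fin 2) :=
  (1 / m) • !₂[2 * ellipticE (am s m) m + (m - 2) * s, -2 * dn s m]

/-- Circular elastica. -/
def circularCurve (s : ℝ) : EuclideanSpace ℝ (Fin 2) := !₂[Real.sin s, -Real.cos s]

end

end Elastica

namespace Elastica

/-! ## Calculus of the Jacobi elliptic functions -/

/-! In the plane the normal component of the elastica equation is the scalar equation `2k'' = λk -
k³`, whose first integral is `e = k'² + k⁴/4 - λk²/2`. Each model curvature solves it with its own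
multiplier, and scaling by `r > 0`, a sign and a parameter shift produce further solutions. The
values of `k, k'` at `0` select the model: `e > 0` is wavelike. If `e ≤ 0` and `k = 0`, then `k' =
0` and the curve is straight. If `k ≠ 0`, then `e = 0` is borderline, while `e < 0` is orbitlike or
circular according to whether `λ²/4 + e = k'² + (k² - λ)²/4` is positive or zero. The matching
lemmas solve for `m`, `r` and the phase; `IsFramedElastica.represented` then propagates the match
from curvature to tangent to curve by uniqueness. The assertions about the models reduce through
`IsAngleCurve` to three scalar derivatives. -/

lemma one_sub_mul_sin_sq_pos {m : ℝ} (h0 : 0 ≤ m) (h1 : m < 1) (x : ℝ) :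
    0 < 1 - m * Real.sin x ^ 2 := by
  nlinarith [Real.sin_sq_le_one x, sq_nonneg (Real.sin x)]

lemma hasDerivAt_ellipticF {m : ℝ} (h0 : 0 ≤ m) (h1 : m < 1) (x : ℝ) :
    HasDerivAt (fun y => ellipticF y m) (1 / Real.sqrt (1 - m * Real.sin x ^ 2)) x := by
  have hc : Continuous (fun θ : ℝ => 1 / Real.sqrt (1 - m * Real.sin θ ^ 2)) :=
    continuous_const.div (by fun_prop)
      fun θ => (Real.sqrt_pos.2 (one_sub_mul_sin_sq_pos h0 h1 θ)).ne'
  exact intervalIntegral.integral_hasDerivAt_right (hc.intervalIntegrable _ _)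
    hc.stronglyMeasurable.stronglyMeasurableAtFilter hc.continuousAt

lemma hasDerivAt_ellipticE (m x : ℝ) :
    HasDerivAt (fun y => ellipticE y m) (Real.sqrt (1 - m * Real.sin x ^ 2)) x := by
  have hc : Continuous (fun θ : ℝ => Real.sqrt (1 - m * Real.sin θ ^ 2)) := by fun_prop
  exact intervalIntegral.integral_hasDerivAt_right (hc.intervalIntegrable _ _)
    hc.stronglyMeasurable.stronglyMeasurableAtFilter hc.continuousAt

lemma ellipticF_am {m : ℝ} (h0 : 0 ≤ m) (h1 : m < 1) (x : ℝ) : ellipticF (am x m) m = x :=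
  Function.rightInverse_invFun (ellipticF_bijective h0 h1).surjective x

lemma am_ellipticF {m : ℝ} (h0 : 0 ≤ m) (h1 : m < 1) (x : ℝ) : am (ellipticF x m) m = x :=
  Function.leftInverse_invFun (ellipticF_bijective h0 h1).injective x

lemma strictMono_ellipticF {m : ℝ} (h0 : 0 ≤ m) (h1 : m < 1) :
    StrictMono fun y => ellipticF y m :=
  strictMono_of_hasDerivAt_pos (hasDerivAt_ellipticF h0 h1)
    fun x => one_div_pos.2 (Real.sqrt_pos.2 (one_sub_mul_sin_sq_pos h0 h1 x))

/-- A monotone surjection of the line is continuous; the inverse function rule for `am` needs this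
first. -/
lemma continuous_am {m : ℝ} (h0 : 0 ≤ m) (h1 : m < 1) : Continuous fun x => am x m := by
  have hmono : Monotone fun x => am x m := fun x y hxy => by
    refine (strictMono_ellipticF h0 h1).le_iff_le.1 ?_
    simpa only [ellipticF_am h0 h1] using hxy
  exact hmono.continuous_of_surjective fun x => ⟨ellipticF x m, am_ellipticF h0 h1 x⟩

lemma hasDerivAt_am {m : ℝ} (h0 : 0 ≤ m) (h1 : m < 1) (x : ℝ) :
    HasDerivAt (fun x => am x m) (dn x m) x := by
  have hp := Real.sqrt_pos.2 (one_sub_mul_sin_sq_pos h0 h1 (am x m))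
  have := (hasDerivAt_ellipticF h0 h1 (am x m)).of_local_left_inverse
    (continuous_am h0 h1).continuousAt (one_div_pos.2 hp).ne'
    (Filter.Eventually.of_forall (ellipticF_am h0 h1))
  simpa [dn] using this

lemma dn_pos {m : ℝ} (h0 : 0 ≤ m) (h1 : m < 1) (x : ℝ) : 0 < dn x m :=
  Real.sqrt_pos.2 (one_sub_mul_sin_sq_pos h0 h1 _)

lemma dn_sq {m : ℝ} (h0 : 0 ≤ m) (h1 : m < 1) (x : ℝ) : dn x m ^ 2 = 1 - m * sn x m ^ 2 :=
  Real.sq_sqrt (one_sub_mul_sin_sq_pos h0 h1 _).le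

lemma sn_sq_add_cn_sq (x m : ℝ) : sn x m ^ 2 + cn x m ^ 2 = 1 := Real.sin_sq_add_cos_sq _

lemma hasDerivAt_sn {m : ℝ} (h0 : 0 ≤ m) (h1 : m < 1) (x : ℝ) :
    HasDerivAt (fun x => sn x m) (cn x m * dn x m) x := (hasDerivAt_am h0 h1 x).sin

lemma hasDerivAt_cn {m : ℝ} (h0 : 0 ≤ m) (h1 : m < 1) (x : ℝ) :
    HasDerivAt (fun x => cn x m) (-(sn x m * dn x m)) x := by
  refine (hasDerivAt_am h0 h1 x).cos.congr_deriv ?_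
  rw [sn, neg_mul]

lemma hasDerivAt_dn {m : ℝ} (h0 : 0 ≤ m) (h1 : m < 1) (x : ℝ) :
    HasDerivAt (fun x => dn x m) (-(m * sn x m * cn x m)) x := by
  have h := ((((hasDerivAt_sn h0 h1 x).pow 2).const_mul m).const_sub 1).sqrt
    (one_sub_mul_sin_sq_pos h0 h1 (am x m)).ne'
  have hd := dn_pos h0 h1 x
  refine h.congr_deriv ?_
  change _ / (2 * dn x m) = _
  push_cast
  field_simp

lemma hasDerivAt_ellipticE_am {m : ℝ} (h0 : 0 ≤ m) (h1 : m < 1) (x : ℝ) :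
    HasDerivAt (fun x => ellipticE (am x m) m) (dn x m ^ 2) x := by
  have := (hasDerivAt_ellipticE m (am x m)).comp x (hasDerivAt_am h0 h1 x)
  rw [sq]
  exact this

lemma contDiff_of_hasDerivAt {f f' : ℝ → ℝ} {n : ℕ} (h : ∀ x, HasDerivAt f (f' x) x)
    (hf' : ContDiff ℝ n f') : ContDiff ℝ (n + 1 : ℕ) f := by
  push_cast
  rw [contDiff_succ_iff_deriv]
  refine ⟨fun x => (h x).differentiableAt, by simp, ?_⟩
  rwa [show deriv f = f' from funext fun x => (h x).deriv]

lemma contDiff_infty_of_hasDerivAt {f f' : ℝ → ℝ} (h : ∀ x, HasDerivAt f (f' x) x)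
    (hf' : ContDiff ℝ ∞ f') : ContDiff ℝ ∞ f :=
  contDiff_infty.2 fun n =>
    (contDiff_of_hasDerivAt h (contDiff_infty.1 hf' n)).of_le (by exact_mod_cast n.le_succ)

/-- Bootstrapping: the derivative `√(1 - m sin² am)` is as smooth as `am` itself, because the
radicand stays positive, so each step gains one order. -/
lemma contDiff_am {m : ℝ} (h0 : 0 ≤ m) (h1 : m < 1) : ContDiff ℝ ∞ fun x => am x m := by
  refine contDiff_infty.2 fun n => ?_
  induction n with
  | zero => exact_mod_cast contDiff_zero.2 (continuous_am h0 h1)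
  | succ n ih =>
    refine contDiff_of_hasDerivAt (hasDerivAt_am h0 h1) ?_
    exact (contDiff_const.sub (contDiff_const.mul (ih.sin.pow 2))).sqrt
      fun x => (one_sub_mul_sin_sq_pos h0 h1 _).ne'

lemma contDiff_cn {m : ℝ} (h0 : 0 ≤ m) (h1 : m < 1) : ContDiff ℝ ∞ fun x => cn x m :=
  (contDiff_am h0 h1).cos

lemma contDiff_dn {m : ℝ} (h0 : 0 ≤ m) (h1 : m < 1) : ContDiff ℝ ∞ fun x => dn x m :=
  (contDiff_const.sub (contDiff_const.mul ((contDiff_am h0 h1).sin.pow 2))).sqrt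
    fun _ => (one_sub_mul_sin_sq_pos h0 h1 _).ne'

/-! ## Hyperbolic functions -/

lemma sech_pos (x : ℝ) : 0 < sech x := one_div_pos.2 (Real.cosh_pos x)

lemma sech_sq (x : ℝ) : sech x ^ 2 = 1 - Real.tanh x ^ 2 := by
  have h := Real.cosh_pos x
  rw [sech, Real.tanh_eq_sinh_div_cosh]
  field_simp
  linarith [Real.cosh_sq x]

lemma hasDerivAt_sech (x : ℝ) : HasDerivAt sech (-(sech x * Real.tanh x)) x := by
  have h := (Real.cosh_pos x).ne'
  have := (hasDerivAt_const x (1 : ℝ)).div (Real.hasDerivAt_cosh x) h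
  refine this.congr_deriv ?_
  rw [sech, Real.tanh_eq_sinh_div_cosh]
  field_simp
  ring

lemma hasDerivAt_tanh_sech (x : ℝ) : HasDerivAt Real.tanh (sech x ^ 2) x := by
  have h := (Real.cosh_pos x).ne'
  have := (Real.hasDerivAt_sinh x).div (Real.hasDerivAt_cosh x) h
  rw [show Real.tanh = Real.sinh / Real.cosh from funext Real.tanh_eq_sinh_div_cosh]
  refine this.congr_deriv ?_
  rw [sech]
  field_simp
  linarith [Real.cosh_sq x]

lemma contDiff_sech : ContDiff ℝ ∞ sech :=
  contDiff_const.div Real.contDiff_cosh fun x => (Real.cosh_pos x).ne'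

lemma cos_two_mul_arcsin {z : ℝ} (h : z ^ 2 ≤ 1) : Real.cos (2 * Real.arcsin z) = 1 - 2 * z ^ 2 := by
  rw [Real.cos_two_mul, Real.cos_sq', Real.sin_arcsin] <;> nlinarith

lemma sin_two_mul_arcsin {z : ℝ} (h : z ^ 2 ≤ 1) :
    Real.sin (2 * Real.arcsin z) = 2 * z * Real.sqrt (1 - z ^ 2) := by
  rw [Real.sin_two_mul, Real.cos_arcsin, Real.sin_arcsin] <;> nlinarith

/-! ## Plane curves with prescribed tangential angle -/

/-- `γ` is the curve with unit tangent `(cos θ, sin θ)` and signed curvature `θ' = k`. -/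
structure IsAngleCurve (γ : ℝ → EuclideanSpace ℝ (Fin 2)) (θ k : ℝ → ℝ) : Prop where
  hasDerivAt_fst : ∀ s, HasDerivAt (fun s => γ s 0) (Real.cos (θ s)) s
  hasDerivAt_snd : ∀ s, HasDerivAt (fun s => γ s 1) (Real.sin (θ s)) s
  hasDerivAt_angle : ∀ s, HasDerivAt θ (k s) s

lemma hasDerivAt_euclidean_two {f : ℝ → EuclideanSpace ℝ (Fin 2)} {a b s : ℝ}
    (h0 : HasDerivAt (fun s => f s 0) a s) (h1 : HasDerivAt (fun s => f s 1) b s) :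
    HasDerivAt f !₂[a, b] s := by
  rw [hasDerivAt_iff_hasFDerivAt, ← hasFDerivWithinAt_univ, hasFDerivWithinAt_euclidean]
  intro i
  rw [hasFDerivWithinAt_univ, hasFDerivAt_iff_hasDerivAt]
  fin_cases i
  · simpa using h0
  · simpa using h1

/-- Smoothness climbs from `k` to `θ` to `γ`, and unit speed makes arclength derivatives ordinary
ones. -/
lemma IsAngleCurve.isArclengthCurveWith {γ : ℝ → EuclideanSpace ℝ (Fin 2)} {θ k : ℝ → ℝ}
    (h : IsAngleCurve γ θ k) (hk : ContDiff ℝ ∞ k) : IsArclengthCurveWith γ θ k := by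
  have hθ : ContDiff ℝ ∞ θ := contDiff_infty_of_hasDerivAt h.hasDerivAt_angle hk
  have hγ' : ∀ s, HasDerivAt γ !₂[Real.cos (θ s), Real.sin (θ s)] s := fun s =>
    hasDerivAt_euclidean_two (h.hasDerivAt_fst s) (h.hasDerivAt_snd s)
  have hγ : ContDiff ℝ ∞ γ := by
    rw [contDiff_euclidean]
    intro i
    fin_cases i
    · exact contDiff_infty_of_hasDerivAt h.hasDerivAt_fst hθ.cos
    · exact contDiff_infty_of_hasDerivAt h.hasDerivAt_snd hθ.sin
  have hn : ∀ s, ‖derivWithin γ Set.univ s‖ = 1 := fun s => by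
    rw [derivWithin_univ, (hγ' s).deriv, EuclideanSpace.norm_eq]
    simp
  have h1 : arcDerivIter Set.univ γ 1 = fun s => !₂[Real.cos (θ s), Real.sin (θ s)] := by
    funext s
    change ‖derivWithin γ Set.univ s‖⁻¹ • derivWithin γ Set.univ s = _
    rw [hn, inv_one, one_smul, derivWithin_univ, (hγ' s).deriv]
  have h2 : ∀ s, arcDerivIter Set.univ γ 2 s =
      !₂[-Real.sin (θ s) * k s, Real.cos (θ s) * k s] := fun s => by
    change ‖derivWithin γ Set.univ s‖⁻¹ • derivWithin (arcDerivIter Set.univ γ 1) Set.univ s = _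
    rw [hn, inv_one, one_smul, derivWithin_univ, h1]
    exact (hasDerivAt_euclidean_two (h.hasDerivAt_angle s).cos (h.hasDerivAt_angle s).sin).deriv
  refine ⟨⟨⟨hγ.contDiffOn, fun s _ hs => ?_⟩, fun s _ => hn s⟩,
    ⟨hθ.continuous.continuousOn, fun s _ => by rw [h1]⟩, fun s => ?_⟩
  · have := hn s
    rw [hs, norm_zero] at this
    exact zero_ne_one this
  · rw [signedCurvature, h2, h1]
    simp only [rotHalfPi, PiLp.inner_apply, Fin.sum_univ_two, RCLike.inner_apply, conj_trivial]
    simp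
    linear_combination k s * Real.sin_sq_add_cos_sq (θ s)

lemma isAngleCurve_linear : IsAngleCurve linearCurve (fun _ => 0) (fun _ => 0) where
  hasDerivAt_fst s := (hasDerivAt_id s).congr_deriv Real.cos_zero.symm
  hasDerivAt_snd s := by simpa [linearCurve] using hasDerivAt_const s (0 : ℝ)
  hasDerivAt_angle s := hasDerivAt_const s 0

lemma isAngleCurve_circular : IsAngleCurve circularCurve (fun s => s) (fun _ => 1) where
  hasDerivAt_fst s := Real.hasDerivAt_sin s
  hasDerivAt_snd s := (Real.hasDerivAt_cos s).neg.congr_deriv (neg_neg _)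
  hasDerivAt_angle s := hasDerivAt_id s

lemma isAngleCurve_borderline :
    IsAngleCurve borderlineCurve (fun s => 2 * Real.arcsin (Real.tanh s)) (fun s => 2 * sech s) where
  hasDerivAt_fst s := by
    have hs := sech_sq s
    rw [cos_two_mul_arcsin (by nlinarith [sech_pos s])]
    have h := ((hasDerivAt_tanh_sech s).const_mul 2).sub (hasDerivAt_id s)
    refine h.congr_deriv ?_
    linear_combination 2 * hs
  hasDerivAt_snd s := by
    have hs := sech_sq s
    rw [sin_two_mul_arcsin (by nlinarith [sech_pos s]), ← hs, Real.sqrt_sq (sech_pos s).le]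
    refine ((hasDerivAt_sech s).const_mul (-2)).congr_deriv ?_
    ring
  hasDerivAt_angle s := by
    have hs := sech_sq s
    have hp := sech_pos s
    have h := ((Real.hasDerivAt_arcsin (x := Real.tanh s) (by nlinarith) (by nlinarith)).comp s
      (hasDerivAt_tanh_sech s)).const_mul 2
    refine h.congr_deriv ?_
    rw [← hs, Real.sqrt_sq hp.le]
    field_simp

lemma isAngleCurve_wavelike {m : ℝ} (h0 : 0 ≤ m) (h1 : m < 1) :
    IsAngleCurve (wavelikeCurve m) (fun s => 2 * Real.arcsin (Real.sqrt m * sn s m))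
      (fun s => 2 * Real.sqrt m * cn s m) := by
  have hz : ∀ s, 1 - (Real.sqrt m * sn s m) ^ 2 = dn s m ^ 2 := fun s => by
    rw [dn_sq h0 h1, mul_pow, Real.sq_sqrt h0]
  have hp := dn_pos h0 h1
  -- Strict, since `arcsin` is not differentiable at `±1`; it comes from `dn > 0`.
  have hz1 : ∀ s, (Real.sqrt m * sn s m) ^ 2 < 1 := fun s => by nlinarith [hz s, hp s]
  refine ⟨fun s => ?_, fun s => ?_, fun s => ?_⟩
  · rw [cos_two_mul_arcsin (hz1 s).le]
    refine (((hasDerivAt_ellipticE_am h0 h1 s).const_mul 2).sub (hasDerivAt_id s)).congr_deriv ?_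
    linear_combination -2 * hz s
  · rw [sin_two_mul_arcsin (hz1 s).le, hz, Real.sqrt_sq (hp s).le]
    refine ((hasDerivAt_cn h0 h1 s).const_mul (-2 * Real.sqrt m)).congr_deriv ?_
    ring
  · have h := ((Real.hasDerivAt_arcsin (x := Real.sqrt m * sn s m) (by nlinarith [hz1 s])
      (by nlinarith [hz1 s])).comp s ((hasDerivAt_sn h0 h1 s).const_mul (Real.sqrt m))).const_mul 2
    refine h.congr_deriv ?_
    rw [hz, Real.sqrt_sq (hp s).le]
    have := hp s
    field_simp

lemma isAngleCurve_orbitlike {m : ℝ} (h0 : 0 < m) (h1 : m < 1) :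
    IsAngleCurve (orbitlikeCurve m) (fun s => 2 * am s m) (fun s => 2 * dn s m) where
  hasDerivAt_fst s := by
    have h := ((((hasDerivAt_ellipticE_am h0.le h1 s).const_mul 2).add
      ((hasDerivAt_id s).const_mul (m - 2))).const_mul (1 / m))
    refine h.congr_deriv ?_
    rw [Real.cos_two_mul, Real.cos_sq', dn_sq h0.le h1, sn]
    field_simp
    ring
  hasDerivAt_snd s := by
    refine (((hasDerivAt_dn h0.le h1 s).const_mul (-2)).const_mul (1 / m)).congr_deriv ?_
    rw [Real.sin_two_mul, sn, cn]
    field_simp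
  hasDerivAt_angle s := (hasDerivAt_am h0.le h1 s).const_mul 2

/-! ## The curvature equation of planar elasticae -/

/-- The unit tangent `(u, v)`, the signed curvature `k` and its derivative `p` along the planar
elastica `γ : [0, L] → ℝ²` with multiplier `lam`. -/
structure IsFramedElastica (L lam : ℝ) (γ : ℝ → EuclideanSpace ℝ (Fin 2)) (u v k p : ℝ → ℝ) :
    Prop where
  fst : ∀ s ∈ Set.Icc 0 L, HasDerivWithinAt (fun s => γ s 0) (u s) (Set.Icc 0 L) s
  snd : ∀ s ∈ Set.Icc 0 L, HasDerivWithinAt (fun s => γ s 1) (v s) (Set.Icc 0 L) s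
  unit : ∀ s ∈ Set.Icc 0 L, u s ^ 2 + v s ^ 2 = 1
  tangent_fst : ∀ s ∈ Set.Icc 0 L, HasDerivWithinAt u (-(k s * v s)) (Set.Icc 0 L) s
  tangent_snd : ∀ s ∈ Set.Icc 0 L, HasDerivWithinAt v (k s * u s) (Set.Icc 0 L) s
  curvature : ∀ s ∈ Set.Icc 0 L, HasDerivWithinAt k (p s) (Set.Icc 0 L) s
  curvature_deriv : ∀ s ∈ Set.Icc 0 L,
    HasDerivWithinAt p ((lam * k s - k s ^ 3) / 2) (Set.Icc 0 L) s

lemma contDiffOn_arcDerivIter {n : ℕ} {S : Set ℝ} (hS : UniqueDiffOn ℝ S)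
    {γ : ℝ → EuclideanSpace ℝ (Fin n)} (h : IsArclengthParametrized S γ) (j : ℕ) :
    ContDiffOn ℝ ∞ (arcDerivIter S γ j) S := by
  induction j with
  | zero => exact h.1.1
  | succ j ih =>
    refine (ih.derivWithin hS (m := ∞) (by simp)).congr fun s hs => ?_
    rw [arcDerivIter, Function.iterate_succ_apply', arcDeriv, h.2 s hs, inv_one, one_smul]
    rfl

lemma hasDerivWithinAt_arcDerivIter {n : ℕ} {S : Set ℝ} (hS : UniqueDiffOn ℝ S)
    {γ : ℝ → EuclideanSpace ℝ (Fin n)} (h : IsArclengthParametrized S γ) (j : ℕ)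
    {s : ℝ} (hs : s ∈ S) :
    HasDerivWithinAt (arcDerivIter S γ j) (arcDerivIter S γ (j + 1) s) S s := by
  have := (((contDiffOn_arcDerivIter hS h j).differentiableOn (by simp)) s hs).hasDerivWithinAt
  refine this.congr_deriv ?_
  rw [arcDerivIter, arcDerivIter, Function.iterate_succ_apply', arcDeriv, h.2 s hs, inv_one,
    one_smul]

lemma hasDerivWithinAt_euclidean_apply {n : ℕ} {f : ℝ → EuclideanSpace ℝ (Fin n)}
    {f' : EuclideanSpace ℝ (Fin n)} {S : Set ℝ} {s : ℝ} (h : HasDerivWithinAt f f' S s)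
    (i : Fin n) : HasDerivWithinAt (fun s => f s i) (f' i) S s :=
  (EuclideanSpace.proj (𝕜 := ℝ) i).hasFDerivAt.comp_hasDerivWithinAt s h

lemma deriv_eq_zero_of_eqOn_const {S : Set ℝ} (hS : UniqueDiffOn ℝ S) {f : ℝ → ℝ} {c f' s : ℝ}
    (hf : ∀ x ∈ S, f x = c) (hs : s ∈ S) (h : HasDerivWithinAt f f' S s) : f' = 0 :=
  (hS s hs).eq_deriv _ h ((hasDerivWithinAt_const s S c).congr hf (hf s hs))

/-- With `T j` the `j`-th derivative, the witnesses are `k = det (T 1, T 2)` and `p = det (T 1, T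
3)`. Differentiating `|T 1|² = 1` once and twice gives the tangential components of `T 2` and `T 3`.
-/
lemma exists_isFramedElastica {L lam : ℝ} (hL : 0 < L) {γ : ℝ → EuclideanSpace ℝ (Fin 2)}
    (he : IsElasticaWith lam 0 L γ) (h : IsArclengthParametrized (Set.Icc 0 L) γ) :
    ∃ u v k p, IsFramedElastica L lam γ u v k p := by
  have hS : UniqueDiffOn ℝ (Set.Icc 0 L) := uniqueDiffOn_Icc hL
  set T := arcDerivIter (Set.Icc 0 L) γ with hT
  have hd : ∀ j i, ∀ s ∈ Set.Icc 0 L,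
      HasDerivWithinAt (fun s => T j s i) (T (j + 1) s i) (Set.Icc 0 L) s := fun j i s hs =>
    hasDerivWithinAt_euclidean_apply (hasDerivWithinAt_arcDerivIter hS h j hs) i
  have hunit : ∀ s ∈ Set.Icc 0 L, T 1 s 0 ^ 2 + T 1 s 1 ^ 2 = 1 := fun s hs => by
    have h1 : T 1 s = derivWithin γ (Set.Icc 0 L) s := by
      change ‖derivWithin γ (Set.Icc 0 L) s‖⁻¹ • derivWithin γ (Set.Icc 0 L) s = _
      rw [h.2 s hs, inv_one, one_smul]
    have h2 := EuclideanSpace.real_norm_sq_eq (T 1 s)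
    rw [h1, h.2 s hs, Fin.sum_univ_two, ← h1] at h2
    linarith
  have horth : ∀ s ∈ Set.Icc 0 L, T 1 s 0 * T 2 s 0 + T 1 s 1 * T 2 s 1 = 0 := fun s hs => by
    have := deriv_eq_zero_of_eqOn_const hS hunit hs (((hd 1 0 s hs).pow 2).add ((hd 1 1 s hs).pow 2))
    norm_num at this
    linarith
  have hthird : ∀ s ∈ Set.Icc 0 L, T 1 s 0 * T 3 s 0 + T 1 s 1 * T 3 s 1
      = -(T 2 s 0 ^ 2 + T 2 s 1 ^ 2) := fun s hs => by
    have := deriv_eq_zero_of_eqOn_const hS horth hs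
      (((hd 1 0 s hs).mul (hd 2 0 s hs)).add ((hd 1 1 s hs).mul (hd 2 1 s hs)))
    norm_num at this
    linarith
  refine ⟨fun s => T 1 s 0, fun s => T 1 s 1, fun s => T 1 s 0 * T 2 s 1 - T 1 s 1 * T 2 s 0,
    fun s => T 1 s 0 * T 3 s 1 - T 1 s 1 * T 3 s 0, hd 0 0, hd 0 1, hunit,
    fun s hs => (hd 1 0 s hs).congr_deriv ?_, fun s hs => (hd 1 1 s hs).congr_deriv ?_,
    fun s hs => (((hd 1 0 s hs).mul (hd 2 1 s hs)).sub
      ((hd 1 1 s hs).mul (hd 2 0 s hs))).congr_deriv ?_,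
    fun s hs => (((hd 1 0 s hs).mul (hd 3 1 s hs)).sub
      ((hd 1 1 s hs).mul (hd 3 0 s hs))).congr_deriv ?_⟩
  · linear_combination T 1 s 0 * horth s hs - T 2 s 0 * hunit s hs
  · linear_combination T 1 s 1 * horth s hs - T 2 s 1 * hunit s hs
  · norm_num
    ring
  · have hE := he.2 s hs
    simp only [← hT] at hE
    rw [EuclideanSpace.real_norm_sq_eq, Fin.sum_univ_two] at hE
    have e0 := congrArg (fun w : EuclideanSpace ℝ (Fin 2) => w 0) hE
    have e1 := congrArg (fun w : EuclideanSpace ℝ (Fin 2) => w 1) hE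
    simp only [PiLp.add_apply, PiLp.sub_apply, PiLp.smul_apply, PiLp.zero_apply, smul_eq_mul] at e0 e1
    have ho := horth s hs
    have ht := hthird s hs
    have hu := hunit s hs
    norm_num
    set a := T 1 s 0
    set b := T 1 s 1
    set c := T 2 s 0
    set d := T 2 s 1
    -- In the orthonormal frame `T 2 = κ N`. Hence `p' = det (T 2, T 3) + det (T 1, T 4)`: the first
    -- term is `κ³` by `hthird`, the second is `(λκ - 3κ³)/2` by pairing the elastica equation with
    -- `N`.
    obtain ⟨κ, hκ⟩ : ∃ κ, κ = a * d - b * c := ⟨_, rfl⟩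
    have hc : c = -(κ * b) := by rw [hκ]; linear_combination a * ho - c * hu
    have hd' : d = κ * a := by rw [hκ]; linear_combination b * ho - d * hu
    rw [← hκ]
    rw [hc, hd'] at e0 e1 ht ⊢
    linear_combination (a * e1 - b * e0) / 2 - κ * ht
      + (lam * κ / 2 - κ ^ 3 / 2 * (1 + 3 * (a ^ 2 + b ^ 2))) * hu

/-! ## Uniqueness for the curvature and frame equations -/

lemma eq_left_of_hasDerivWithinAt_zero {L : ℝ} {f : ℝ → ℝ}
    (h : ∀ s ∈ Set.Icc 0 L, HasDerivWithinAt f 0 (Set.Icc 0 L) s) {s : ℝ}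
    (hs : s ∈ Set.Icc 0 L) : f s = f 0 :=
  constant_of_derivWithin_zero (fun x hx => (h x hx).differentiableWithinAt)
    (fun x hx => (h x ⟨hx.1, hx.2.le⟩).derivWithin
      (uniqueDiffOn_Icc (hx.1.trans_lt hx.2) x ⟨hx.1, hx.2.le⟩)) s hs

/-- The zero solution is the only one of `w'' = g w` with vanishing initial data. -/
lemma eq_zero_of_linear_second_order {L C : ℝ} {w q g : ℝ → ℝ}
    (hw : ∀ s ∈ Set.Icc 0 L, HasDerivWithinAt w (q s) (Set.Icc 0 L) s)
    (hq : ∀ s ∈ Set.Icc 0 L, HasDerivWithinAt q (g s * w s) (Set.Icc 0 L) s)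
    (hg : ∀ s ∈ Set.Icc 0 L, |g s| ≤ C) (hw0 : w 0 = 0) (hq0 : q 0 = 0) {s : ℝ}
    (hs : s ∈ Set.Icc 0 L) : w s = 0 := by
  -- A Gronwall argument: `w² + q²` grows at rate at most `1 + C`, so the exponential weight makes
  -- it nonincreasing from the value `0`.
  have hd : ∀ s ∈ Set.Icc 0 L, HasDerivWithinAt
      (fun s => (w s ^ 2 + q s ^ 2) * Real.exp (-((1 + C) * s)))
      ((2 * w s * q s * (1 + g s) - (1 + C) * (w s ^ 2 + q s ^ 2)) * Real.exp (-((1 + C) * s)))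
      (Set.Icc 0 L) s := fun s hs => by
    have he := (((hasDerivWithinAt_id s (Set.Icc 0 L)).const_mul (1 + C)).neg).exp
    refine ((((hw s hs).pow 2).add ((hq s hs).pow 2)).mul he).congr_deriv ?_
    simp
    ring
  have hanti := antitoneOn_of_hasDerivWithinAt_nonpos (convex_Icc 0 L)
    (fun s hs => (hd s hs).continuousWithinAt)
    (fun s hs => (hd s (interior_subset hs)).mono interior_subset) fun s hs => by
      have hg' := abs_le.1 (hg s (interior_subset hs))
      refine mul_nonpos_of_nonpos_of_nonneg ?_ (Real.exp_pos _).le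
      have h1 : 2 * w s * q s * (1 + g s) ≤ |2 * w s * q s| * |1 + g s| := by
        rw [← abs_mul]; exact le_abs_self _
      have h2 : |1 + g s| ≤ 1 + C := abs_le.2 ⟨by linarith, by linarith⟩
      have h3 : |2 * w s * q s| ≤ w s ^ 2 + q s ^ 2 :=
        abs_le.2 ⟨by nlinarith [sq_nonneg (w s + q s)], by nlinarith [sq_nonneg (w s - q s)]⟩
      have h4 : |2 * w s * q s| * |1 + g s| ≤ (w s ^ 2 + q s ^ 2) * (1 + C) :=
        mul_le_mul h3 h2 (abs_nonneg _) (by positivity)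
      linarith
  have h0 := hanti ⟨le_rfl, hs.1.trans hs.2⟩ hs hs.1
  simp only [hw0, hq0] at h0
  have := Real.exp_pos (-((1 + C) * s))
  have h5 : w s ^ 2 + q s ^ 2 ≤ 0 := by
    by_contra! hc
    nlinarith [mul_pos hc this]
  nlinarith [sq_nonneg (w s), sq_nonneg (q s)]

/-- Factoring `k³ - h³` makes `k - h` solve a linear equation, with a coefficient continuous and so
bounded on the compact interval. -/
lemma curvature_unique {L lam : ℝ} {k p h q : ℝ → ℝ}
    (hk : ∀ s ∈ Set.Icc 0 L, HasDerivWithinAt k (p s) (Set.Icc 0 L) s)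
    (hp : ∀ s ∈ Set.Icc 0 L, HasDerivWithinAt p ((lam * k s - k s ^ 3) / 2) (Set.Icc 0 L) s)
    (hh : ∀ s ∈ Set.Icc 0 L, HasDerivWithinAt h (q s) (Set.Icc 0 L) s)
    (hq : ∀ s ∈ Set.Icc 0 L, HasDerivWithinAt q ((lam * h s - h s ^ 3) / 2) (Set.Icc 0 L) s)
    (h0 : k 0 = h 0) (h1 : p 0 = q 0) {s : ℝ} (hs : s ∈ Set.Icc 0 L) : k s = h s := by
  have hkc : ContinuousOn k (Set.Icc 0 L) := fun s hs => (hk s hs).continuousWithinAt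
  have hhc : ContinuousOn h (Set.Icc 0 L) := fun s hs => (hh s hs).continuousWithinAt
  have hc : ContinuousOn (fun s => (lam - (k s ^ 2 + k s * h s + h s ^ 2)) / 2) (Set.Icc 0 L) := by
    fun_prop
  obtain ⟨C, hC⟩ := isCompact_Icc.exists_bound_of_continuousOn hc
  refine sub_eq_zero.1 (eq_zero_of_linear_second_order (w := fun s => k s - h s)
    (q := fun s => p s - q s) (fun s hs => (hk s hs).sub (hh s hs))
    (fun s hs => ((hp s hs).sub (hq s hs)).congr_deriv ?_) hC (sub_eq_zero.2 h0)
    (sub_eq_zero.2 h1) hs)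
  ring

/-- The frame system is skew-symmetric, so the squared distance between two solutions is constant.
-/
lemma frame_unique {L : ℝ} {k u v u' v' : ℝ → ℝ}
    (hu : ∀ s ∈ Set.Icc 0 L, HasDerivWithinAt u (-(k s * v s)) (Set.Icc 0 L) s)
    (hv : ∀ s ∈ Set.Icc 0 L, HasDerivWithinAt v (k s * u s) (Set.Icc 0 L) s)
    (hu' : ∀ s ∈ Set.Icc 0 L, HasDerivWithinAt u' (-(k s * v' s)) (Set.Icc 0 L) s)
    (hv' : ∀ s ∈ Set.Icc 0 L, HasDerivWithinAt v' (k s * u' s) (Set.Icc 0 L) s)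
    (h0 : u 0 = u' 0) (h1 : v 0 = v' 0) {s : ℝ} (hs : s ∈ Set.Icc 0 L) :
    u s = u' s ∧ v s = v' s := by
  have := eq_left_of_hasDerivWithinAt_zero (f := fun s => (u s - u' s) ^ 2 + (v s - v' s) ^ 2)
    (fun s hs => ((((hu s hs).sub (hu' s hs)).pow 2).add
      (((hv s hs).sub (hv' s hs)).pow 2)).congr_deriv (by norm_num; ring)) hs
  simp only [h0, h1, sub_self] at this
  constructor <;> nlinarith [sq_nonneg (u s - u' s), sq_nonneg (v s - v' s)]

/-! ## Comparison with a model curve -/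

/-- The orthogonal matrix with columns `(c, d)` and `ε (-d, c)`, as a linear isometry. -/
noncomputable def planeIsometry (c d ε : ℝ) (h : c ^ 2 + d ^ 2 = 1) (hε : ε ^ 2 = 1) :
    EuclideanSpace ℝ (Fin 2) ≃ₗᵢ[ℝ] EuclideanSpace ℝ (Fin 2) :=
  LinearIsometry.toLinearIsometryEquiv
    { toFun := fun w => !₂[c * w 0 - ε * d * w 1, d * w 0 + ε * c * w 1]
      map_add' := fun w z => by ext i; fin_cases i <;> simp <;> ring
      map_smul' := fun r w => by ext i; fin_cases i <;> simp <;> ring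
      norm_map' := fun w => by
        rw [← sq_eq_sq₀ (norm_nonneg _) (norm_nonneg _), EuclideanSpace.real_norm_sq_eq,
          EuclideanSpace.real_norm_sq_eq, Fin.sum_univ_two, Fin.sum_univ_two]
        simp
        linear_combination (w 0 ^ 2 + ε ^ 2 * w 1 ^ 2) * h + w 1 ^ 2 * hε } rfl

lemma planeIsometry_apply (c d ε : ℝ) (h : c ^ 2 + d ^ 2 = 1) (hε : ε ^ 2 = 1)
    (w : EuclideanSpace ℝ (Fin 2)) : planeIsometry c d ε h hε w =
      !₂[c * w 0 - ε * d * w 1, d * w 0 + ε * c * w 1] := rfl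

/-- A framed elastica whose initial curvature data agree with those of a model curve, up to
scaling and reflection, is represented by that model curve up to similarity. -/
theorem IsFramedElastica.represented {L lam : ℝ} {γ : ℝ → EuclideanSpace ℝ (Fin 2)}
    {u v k p : ℝ → ℝ} (h : IsFramedElastica L lam γ u v k p) (hL : 0 < L)
    {γs : ℝ → EuclideanSpace ℝ (Fin 2)} {θ ks ps : ℝ → ℝ} {lams : ℝ}
    (hs : IsAngleCurve γs θ ks) (hks : ∀ s, HasDerivAt ks (ps s) s)
    (hps : ∀ s, HasDerivAt ps ((lams * ks s - ks s ^ 3) / 2) s)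
    {r ε s₀ : ℝ} (hr : 0 < r) (hε : ε ^ 2 = 1) (hlam : lam = r ^ 2 * lams)
    (hk0 : k 0 = ε * r * ks s₀) (hp0 : p 0 = ε * r ^ 2 * ps s₀) :
    RepresentedUpToSimilarity L γ γs := by
  have hm : ∀ s, HasDerivWithinAt (fun s => r * s + s₀) r (Set.Icc 0 L) s := fun s => by
    simpa using (((hasDerivWithinAt_id s (Set.Icc 0 L)).const_mul r).add_const s₀)
  have hks' : ∀ s ∈ Set.Icc 0 L, HasDerivWithinAt (fun s => ε * r * ks (r * s + s₀))
      (ε * r ^ 2 * ps (r * s + s₀)) (Set.Icc 0 L) s := fun s _ =>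
    (((hks (r * s + s₀)).comp_hasDerivWithinAt s (hm s)).const_mul (ε * r)).congr_deriv (by ring)
  have hps' : ∀ s ∈ Set.Icc 0 L, HasDerivWithinAt (fun s => ε * r ^ 2 * ps (r * s + s₀))
      ((lam * (ε * r * ks (r * s + s₀)) - (ε * r * ks (r * s + s₀)) ^ 3) / 2) (Set.Icc 0 L) s :=
    fun s _ => (((hps (r * s + s₀)).comp_hasDerivWithinAt s (hm s)).const_mul
      (ε * r ^ 2)).congr_deriv (by
        rw [hlam]; linear_combination (ε * r ^ 3 * ks (r * s + s₀) ^ 3 / 2) * hε)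
  have hk : ∀ s ∈ Set.Icc 0 L, k s = ε * r * ks (r * s + s₀) := fun s hs =>
    curvature_unique h.curvature h.curvature_deriv hks' hps' (by simpa using hk0)
      (by simpa using hp0) hs
  have h0 : (0 : ℝ) ∈ Set.Icc 0 L := ⟨le_rfl, hL.le⟩
  have hunit := h.unit 0 h0
  have htrig := Real.sin_sq_add_cos_sq (θ s₀)
  -- In complex notation `c + id = (u 0 + i v 0)(cos θ - iε sin θ)` at `θ = θ s₀`, so that the
  -- isometry carries the model tangent at `s₀` to that of `γ` at `0`.
  obtain ⟨c, hc⟩ : ∃ c, c = u 0 * Real.cos (θ s₀) + ε * v 0 * Real.sin (θ s₀) := ⟨_, rfl⟩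
  obtain ⟨d, hd⟩ : ∃ d, d = v 0 * Real.cos (θ s₀) - ε * u 0 * Real.sin (θ s₀) := ⟨_, rfl⟩
  have hcd : c ^ 2 + d ^ 2 = 1 := by
    rw [hc, hd]
    linear_combination (Real.cos (θ s₀) ^ 2 + ε ^ 2 * Real.sin (θ s₀) ^ 2) * hunit
      + Real.sin (θ s₀) ^ 2 * hε + htrig
  have hθ : ∀ s, HasDerivWithinAt (fun s => θ (r * s + s₀)) (ks (r * s + s₀) * r)
      (Set.Icc 0 L) s := fun s =>
    (hs.hasDerivAt_angle (r * s + s₀)).comp_hasDerivWithinAt s (hm s)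
  have hframe : ∀ s ∈ Set.Icc 0 L,
      u s = c * Real.cos (θ (r * s + s₀)) - ε * d * Real.sin (θ (r * s + s₀)) ∧
      v s = d * Real.cos (θ (r * s + s₀)) + ε * c * Real.sin (θ (r * s + s₀)) := fun s hs => by
    refine frame_unique
      (u' := fun s => c * Real.cos (θ (r * s + s₀)) - ε * d * Real.sin (θ (r * s + s₀)))
      (v' := fun s => d * Real.cos (θ (r * s + s₀)) + ε * c * Real.sin (θ (r * s + s₀)))
      h.tangent_fst h.tangent_snd
      (fun s hs => (((hθ s).cos.const_mul c).sub ((hθ s).sin.const_mul (ε * d))).congr_deriv ?_)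
      (fun s hs => (((hθ s).cos.const_mul d).add ((hθ s).sin.const_mul (ε * c))).congr_deriv ?_)
      ?_ ?_ hs
    · rw [hk s hs]
      linear_combination (ks (r * s + s₀) * r * c * Real.sin (θ (r * s + s₀))) * hε
    · rw [hk s hs]
      linear_combination (ks (r * s + s₀) * r * d * Real.sin (θ (r * s + s₀))) * hε
    · simp only [mul_zero, zero_add]
      rw [hc, hd]
      linear_combination -u 0 * htrig - u 0 * Real.sin (θ s₀) ^ 2 * hε
    · simp only [mul_zero, zero_add]
      rw [hc, hd]
      linear_combination -v 0 * htrig - v 0 * Real.sin (θ s₀) ^ 2 * hε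
  have hX := fun s => (hs.hasDerivAt_fst (r * s + s₀)).comp_hasDerivWithinAt s (hm s)
  have hY := fun s => (hs.hasDerivAt_snd (r * s + s₀)).comp_hasDerivWithinAt s (hm s)
  have hr' := hr.ne'
  let A := planeIsometry c d ε hcd hε
  -- The translation makes the curves agree at `s = 0`; their difference then has zero derivative,
  -- as the tangents coincide.
  refine ⟨r⁻¹, A, γ 0 - r⁻¹ • A (γs s₀), s₀, inv_pos.2 hr, fun s hs' => ?_⟩
  have e0 := eq_left_of_hasDerivWithinAt_zero (fun s hs => ((h.fst s hs).sub
    (((hX s).const_mul c).sub ((hY s).const_mul (ε * d)) |>.const_mul r⁻¹)).congr_deriv (by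
      rw [(hframe s hs).1]; field_simp; ring)) hs'
  have e1 := eq_left_of_hasDerivWithinAt_zero (fun s hs => ((h.snd s hs).sub
    (((hX s).const_mul d).add ((hY s).const_mul (ε * c)) |>.const_mul r⁻¹)).congr_deriv (by
      rw [(hframe s hs).2]; field_simp; ring)) hs'
  simp at e0 e1
  have harg : s / r⁻¹ + s₀ = r * s + s₀ := by field_simp
  rw [harg]
  ext i
  fin_cases i
  · simp [A, planeIsometry_apply]
    linear_combination e0
  · simp [A, planeIsometry_apply]
    linear_combination e1

/-! ## Matching the curvature data with a model curve -/

/-- The first integral of the curvature equation. -/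
noncomputable def curvatureEnergy (lam k p : ℝ) : ℝ := p ^ 2 + k ^ 4 / 4 - lam * k ^ 2 / 2

lemma exists_wavelike_match {lam k p : ℝ} (hE : 0 < curvatureEnergy lam k p) :
    ∃ m ∈ Set.Ioo (0 : ℝ) 1, ∃ r > 0, ∃ s, lam = r ^ 2 * (2 * (2 * m - 1)) ∧
      k = r * (2 * Real.sqrt m * cn s m) ∧ p = r ^ 2 * (-2 * Real.sqrt m * sn s m * dn s m) := by
  obtain ⟨e, he⟩ : ∃ e, e = curvatureEnergy lam k p := ⟨_, rfl⟩
  rw [← he] at hE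
  rw [curvatureEnergy] at he
  -- The model has multiplier `2(2m - 1)` and energy `4m(1 - m)`, for which `λ²/4 + e = 1`. Scaling
  -- by `r` multiplies this by `r⁴`, so `μ = r²` is forced, and `m` follows from `λ`.
  obtain ⟨μ, hμ, hμ2⟩ : ∃ μ > 0, μ ^ 2 = lam ^ 2 / 4 + e :=
    ⟨Real.sqrt (lam ^ 2 / 4 + e), Real.sqrt_pos.2 (by positivity), Real.sq_sqrt (by positivity)⟩
  obtain ⟨m, hm⟩ : ∃ m, lam = μ * (2 * (2 * m - 1)) :=
    ⟨(1 + lam / (2 * μ)) / 2, by field_simp; ring⟩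
  have hem : e = 4 * m * (1 - m) * μ ^ 2 := by rw [hm] at hμ2; linear_combination -hμ2
  have hmm : 0 < m * (1 - m) := by
    by_contra! hc
    nlinarith [mul_nonneg (neg_nonneg.2 hc) (sq_nonneg μ)]
  have hm0 : 0 < m := by nlinarith [sq_nonneg m, sq_nonneg (1 - m)]
  have hm1 : m < 1 := by nlinarith
  obtain ⟨r, hr, rfl⟩ : ∃ r > 0, μ = r ^ 2 := ⟨Real.sqrt μ, Real.sqrt_pos.2 hμ, (Real.sq_sqrt hμ.le).symm⟩
  obtain ⟨q, hq, hqm⟩ : ∃ q > 0, q = Real.sqrt m := ⟨_, Real.sqrt_pos.2 hm0, rfl⟩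
  have hq2 : q ^ 2 = m := by rw [hqm, Real.sq_sqrt hm0.le]
  obtain ⟨c, hc⟩ : ∃ c, k = r * (2 * q * c) := ⟨k / (r * (2 * q)), by field_simp⟩
  have hp2 : p ^ 2 = 4 * m * r ^ 4 * ((1 - c ^ 2) * (1 - m * (1 - c ^ 2))) := by
    have : p ^ 2 = e - (k ^ 2) ^ 2 / 4 + lam * k ^ 2 / 2 := by rw [he]; ring
    rw [this, show k ^ 2 = r ^ 2 * (4 * m * c ^ 2) by rw [hc, ← hq2]; ring, hem, hm]
    ring
  -- Otherwise the formula `hp2` would make `p²` negative; thus `c` is the cosine of a real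
  -- amplitude.
  have hc1 : c ^ 2 ≤ 1 := by
    by_contra! h
    have h1 : 0 < 4 * m * r ^ 4 := by positivity
    have h2 : 0 < (c ^ 2 - 1) * (1 - m * (1 - c ^ 2)) := mul_pos (by linarith) (by nlinarith)
    nlinarith [mul_pos h1 h2, sq_nonneg p]
  have hcos : Real.cos (Real.arccos c) = c := Real.cos_arccos (by nlinarith) (by nlinarith)
  have hsin := Real.sin_sq_add_cos_sq (Real.arccos c)
  rw [hcos] at hsin
  have hdn := Real.sq_sqrt (one_sub_mul_sin_sq_pos hm0.le hm1 (Real.arccos c)).le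
  have hsq : p ^ 2 = (r ^ 2 * (-2 * q * Real.sin (Real.arccos c) *
      Real.sqrt (1 - m * Real.sin (Real.arccos c) ^ 2))) ^ 2 := by
    have h1 : Real.sin (Real.arccos c) ^ 2 = 1 - c ^ 2 := by linarith
    rw [mul_pow, mul_pow, hdn, mul_pow, mul_pow, h1, hq2, hp2]
    ring
  refine ⟨m, ⟨hm0, hm1⟩, r, hr, ?_⟩
  -- The energy fixes `p` only up to sign; reversing the amplitude flips `sn` and keeps `cn`.
  rcases sq_eq_sq_iff_eq_or_eq_neg.1 hsq with h | h
  · refine ⟨ellipticF (Real.arccos c) m, hm, ?_, ?_⟩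
    · rw [cn, am_ellipticF hm0.le hm1, hcos, ← hqm, hc]
    · rw [sn, dn, am_ellipticF hm0.le hm1, ← hqm, h]
  · refine ⟨ellipticF (-Real.arccos c) m, hm, ?_, ?_⟩
    · rw [cn, am_ellipticF hm0.le hm1, Real.cos_neg, hcos, ← hqm, hc]
    · rw [sn, dn, am_ellipticF hm0.le hm1, ← hqm, h, Real.sin_neg, neg_sq]
      ring

lemma exists_orbitlike_match {lam k p : ℝ} (hk : 0 < k) (hE : curvatureEnergy lam k p < 0)
    (hD : 0 < lam ^ 2 / 4 + curvatureEnergy lam k p) :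
    ∃ m ∈ Set.Ioo (0 : ℝ) 1, ∃ r > 0, ∃ s, lam = r ^ 2 * (2 * (2 - m)) ∧
      k = r * (2 * dn s m) ∧ p = r ^ 2 * (-2 * m * sn s m * cn s m) := by
  obtain ⟨e, he⟩ : ∃ e, e = curvatureEnergy lam k p := ⟨_, rfl⟩
  rw [← he] at hE hD
  rw [curvatureEnergy] at he
  have hlam : 0 < lam := by
    by_contra! h
    have h1 := mul_nonneg (neg_nonneg.2 h) (sq_nonneg k)
    have h2 : 0 < k ^ 4 := by positivity
    nlinarith [sq_nonneg p]
  obtain ⟨D, hD0, hD2⟩ : ∃ D > 0, D ^ 2 = lam ^ 2 / 4 + e :=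
    ⟨Real.sqrt (lam ^ 2 / 4 + e), Real.sqrt_pos.2 hD, Real.sq_sqrt hD.le⟩
  have hDlam : D < lam / 2 := by nlinarith
  -- Here the model has `λ/2 = 2 - m` and `λ²/4 + e = m²`. After scaling by `r² = μ`, `λ/2 = (2 -
  -- m)μ` and `D = mμ`, whose sum is `2μ`.
  obtain ⟨μ, hμ, hμe⟩ : ∃ μ > 0, μ = (lam / 2 + D) / 2 := ⟨_, by positivity, rfl⟩
  obtain ⟨m, hm⟩ : ∃ m, D = m * μ := ⟨D / μ, by field_simp⟩
  have hm0 : 0 < m := by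
    by_contra! h
    nlinarith [mul_nonneg (neg_nonneg.2 h) hμ.le]
  have hm1 : m < 1 := by
    by_contra! h
    nlinarith [mul_le_mul_of_nonneg_right h hμ.le]
  have hlm : lam = μ * (2 * (2 - m)) := by linarith
  have hem : e = -4 * (1 - m) * μ ^ 2 := by rw [hlm, hm] at hD2; linear_combination -hD2
  obtain ⟨r, hr, rfl⟩ : ∃ r > 0, μ = r ^ 2 :=
    ⟨Real.sqrt μ, Real.sqrt_pos.2 hμ, (Real.sq_sqrt hμ.le).symm⟩
  obtain ⟨z, hz⟩ : ∃ z, k = r * (2 * z) := ⟨k / (r * 2), by field_simp⟩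
  have hz0 : 0 < z := by
    by_contra! h
    nlinarith [mul_nonneg (neg_nonneg.2 h) hr.le]
  -- `w` is the prospective `sn²`; nonnegativity of `p²` places it in `[0, 1]`.
  obtain ⟨w, hw⟩ : ∃ w, z ^ 2 = 1 - m * w := ⟨(1 - z ^ 2) / m, by field_simp; ring⟩
  have hp2 : p ^ 2 = 4 * m ^ 2 * r ^ 4 * (w * (1 - w)) := by
    have : p ^ 2 = e - (k ^ 2) ^ 2 / 4 + lam * k ^ 2 / 2 := by rw [he]; ring
    rw [this, show k ^ 2 = r ^ 2 * (4 * (1 - m * w)) by rw [hz, ← hw]; ring, hem, hlm]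
    ring
  have hww : 0 ≤ w * (1 - w) := by
    by_contra! h
    have h1 : 0 < 4 * m ^ 2 * r ^ 4 := by positivity
    nlinarith [mul_pos h1 (neg_pos.2 h), sq_nonneg p]
  have hw0 : 0 ≤ w := by nlinarith [sq_nonneg w, sq_nonneg (1 - w)]
  have hw1 : w ≤ 1 := by nlinarith
  obtain ⟨a, ha⟩ : ∃ a, Real.sin a ^ 2 = w := by
    have h1 : Real.sqrt w ≤ 1 := Real.sqrt_le_one.2 hw1
    have h2 := Real.sqrt_nonneg w
    exact ⟨Real.arcsin (Real.sqrt w), by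
      rw [Real.sin_arcsin (by linarith) h1, Real.sq_sqrt hw0]⟩
  have hdn : Real.sqrt (1 - m * Real.sin a ^ 2) = z := by
    rw [ha, ← hw, Real.sqrt_sq hz0.le]
  have hsq : p ^ 2 = (r ^ 2 * (-2 * m * Real.sin a * Real.cos a)) ^ 2 := by
    have h1 : Real.cos a ^ 2 = 1 - w := by rw [Real.cos_sq', ha]
    rw [mul_pow, mul_pow, h1, mul_pow, ha, hp2]
    ring
  refine ⟨m, ⟨hm0, hm1⟩, r, hr, ?_⟩
  rcases sq_eq_sq_iff_eq_or_eq_neg.1 hsq with h | h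
  · refine ⟨ellipticF a m, hlm, ?_, ?_⟩
    · rw [dn, am_ellipticF hm0.le hm1, hdn, hz]
    · rw [sn, cn, am_ellipticF hm0.le hm1, h]
  · refine ⟨ellipticF (-a) m, hlm, ?_, ?_⟩
    · rw [dn, am_ellipticF hm0.le hm1, Real.sin_neg, neg_sq, hdn, hz]
    · rw [sn, cn, am_ellipticF hm0.le hm1, h, Real.sin_neg, Real.cos_neg]
      ring

lemma exists_borderline_match {lam k p : ℝ} (hk : 0 < k) (hE : curvatureEnergy lam k p = 0) :
    ∃ r > 0, ∃ s, lam = r ^ 2 * 2 ∧ k = r * (2 * sech s) ∧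
      p = r ^ 2 * (-2 * sech s * Real.tanh s) := by
  rw [curvatureEnergy] at hE
  have hlam : 0 < lam := by
    by_contra! h
    have h1 := mul_nonneg (neg_nonneg.2 h) (sq_nonneg k)
    have h2 : 0 < k ^ 4 := by positivity
    nlinarith [sq_nonneg p]
  obtain ⟨r, hr, hr2⟩ : ∃ r > 0, r ^ 2 = lam / 2 :=
    ⟨Real.sqrt (lam / 2), Real.sqrt_pos.2 (by positivity), Real.sq_sqrt (by positivity)⟩
  -- `t` is the prospective `tanh`: the model satisfies `k' = -k tanh`. Zero energy then gives `k² =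
  -- 4r²(1 - t²)`, and `k ≠ 0` forces `|t| < 1`.
  obtain ⟨t, ht⟩ : ∃ t, p = -(k * r * t) := ⟨-p / (k * r), by field_simp⟩
  have ht2 : k ^ 2 = 4 * r ^ 2 * (1 - t ^ 2) := by
    have h1 : k ^ 2 * (k ^ 2 - 4 * r ^ 2 * (1 - t ^ 2)) = 0 := by
      rw [ht] at hE
      linear_combination 4 * hE - 4 * k ^ 2 * hr2
    rcases mul_eq_zero.1 h1 with h | h
    · exact absurd h (by positivity)
    · linarith
  have ht1 : t ^ 2 < 1 := by
    by_contra! h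
    nlinarith [mul_nonneg (sq_nonneg r) (sub_nonneg.2 h), sq_pos_of_pos hk]
  have htanh : Real.tanh (Real.artanh t) = t :=
    Real.tanh_artanh ⟨by nlinarith, by nlinarith⟩
  have hsech : k = r * (2 * sech (Real.artanh t)) := by
    have := sech_pos (Real.artanh t)
    rw [← sq_eq_sq₀ hk.le (by positivity), mul_pow, mul_pow, sech_sq, htanh, ht2]
    ring
  refine ⟨r, hr, Real.artanh t, by linarith, hsech, ?_⟩
  rw [htanh, ht]
  linear_combination -(r * t) * hsech

lemma exists_sign_mul_pos {x : ℝ} (hx : x ≠ 0) : ∃ ε : ℝ, ε ^ 2 = 1 ∧ 0 < ε * x := by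
  rcases lt_or_gt_of_ne hx with h | h
  · exact ⟨-1, by norm_num, by linarith⟩
  · exact ⟨1, by norm_num, by linarith⟩

lemma IsFramedElastica.classification {L lam : ℝ} {γ : ℝ → EuclideanSpace ℝ (Fin 2)}
    {u v k p : ℝ → ℝ} (h : IsFramedElastica L lam γ u v k p) (hL : 0 < L) :
    RepresentedUpToSimilarity L γ linearCurve ∨
    (∃ m ∈ Set.Ioo (0 : ℝ) 1, RepresentedUpToSimilarity L γ (wavelikeCurve m)) ∨
    RepresentedUpToSimilarity L γ borderlineCurve ∨
    (∃ m ∈ Set.Ioo (0 : ℝ) 1, RepresentedUpToSimilarity L γ (orbitlikeCurve m)) ∨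
    RepresentedUpToSimilarity L γ circularCurve := by
  rcases lt_or_ge 0 (curvatureEnergy lam (k 0) (p 0)) with hE | hE
  · obtain ⟨m, hm, r, hr, s, hlam, hk, hp⟩ := exists_wavelike_match hE
    have h0 := hm.1.le
    have h1 := hm.2
    refine Or.inr (Or.inl ⟨m, hm, h.represented hL (isAngleCurve_wavelike h0 h1)
      (ps := fun s => -2 * Real.sqrt m * sn s m * dn s m) (lams := 2 * (2 * m - 1))
      (fun s => ((hasDerivAt_cn h0 h1 s).const_mul (2 * Real.sqrt m)).congr_deriv (by ring))
      (fun s => (((hasDerivAt_sn h0 h1 s).const_mul (-2 * Real.sqrt m)).mul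
        (hasDerivAt_dn h0 h1 s)).congr_deriv ?_) hr (ε := 1) (one_pow 2) hlam
      (by rw [one_mul]; exact hk) (by rw [one_mul]; exact hp)⟩)
    have e1 := dn_sq h0 h1 s
    have e2 := sn_sq_add_cn_sq s m
    have e3 := Real.sq_sqrt h0
    linear_combination (-2 * Real.sqrt m * cn s m) * e1 +
      4 * Real.sqrt m * m * cn s m * e2 + 4 * Real.sqrt m * cn s m ^ 3 * e3
  by_cases hk0 : k 0 = 0
  · have hp0 : p 0 = 0 := by
      rw [curvatureEnergy, hk0] at hE
      nlinarith [sq_nonneg (p 0)]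
    -- Zero curvature solves the equation for every multiplier, so no rescaling is needed.
    exact Or.inl (h.represented hL isAngleCurve_linear (ps := fun _ => 0) (lams := lam) (s₀ := 0)
      (fun s => hasDerivAt_const s 0) (fun s => (hasDerivAt_const s (0 : ℝ)).congr_deriv (by simp))
      one_pos (one_pow 2) (by ring) (by simpa using hk0) (by simpa using hp0))
  -- The remaining models have positive curvature, so a reflection may be needed; the energy is even
  -- in `(k, p)`.
  obtain ⟨ε, hε, hpos⟩ := exists_sign_mul_pos hk0
  have hε4 : ε ^ 4 = 1 := by linear_combination (ε ^ 2 + 1) * hε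
  have hen : curvatureEnergy lam (ε * k 0) (ε * p 0) = curvatureEnergy lam (k 0) (p 0) := by
    rw [curvatureEnergy, curvatureEnergy, mul_pow, mul_pow, mul_pow, hε, hε4]
    ring
  have hback : ∀ {x y : ℝ}, ε * x = y → x = ε * y := fun {x y} hxy => by
    rw [← hxy]; linear_combination -x * hε
  rw [← hen] at hE
  rcases hE.lt_or_eq with hE | hE
  · have hD : lam ^ 2 / 4 + curvatureEnergy lam (ε * k 0) (ε * p 0)
        = p 0 ^ 2 + (k 0 ^ 2 - lam) ^ 2 / 4 := by
      rw [hen, curvatureEnergy]; ring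
    have hD0 : 0 ≤ lam ^ 2 / 4 + curvatureEnergy lam (ε * k 0) (ε * p 0) := by
      rw [hD]; positivity
    rcases hD0.lt_or_eq with hDpos | hDz
    · obtain ⟨m, hm, r, hr, s, hlam, hk, hp⟩ := exists_orbitlike_match hpos hE hDpos
      have h0 := hm.1.le
      have h1 := hm.2
      refine Or.inr (Or.inr (Or.inr (Or.inl ⟨m, hm, h.represented hL
        (isAngleCurve_orbitlike hm.1 h1)
        (ps := fun s => -2 * m * sn s m * cn s m) (lams := 2 * (2 - m))
        (fun s => ((hasDerivAt_dn h0 h1 s).const_mul 2).congr_deriv (by ring))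
        (fun s => (((hasDerivAt_sn h0 h1 s).const_mul (-2 * m)).mul
          (hasDerivAt_cn h0 h1 s)).congr_deriv ?_) hr hε hlam
        (by rw [hback hk]; ring) (by rw [hback hp]; ring)⟩)))
      have e1 := dn_sq h0 h1 s
      have e2 := sn_sq_add_cn_sq s m
      linear_combination 4 * dn s m * e1 - 2 * m * dn s m * e2
    -- Both squares vanish: the equilibrium `k² = λ`, a circle with scale `r = ε * k 0 = |k 0|`.
    · have hp0 : p 0 = 0 := by nlinarith [sq_nonneg (p 0), sq_nonneg (k 0 ^ 2 - lam)]
      have hk2 : k 0 ^ 2 - lam = 0 := by nlinarith [sq_nonneg (p 0), sq_nonneg (k 0 ^ 2 - lam)]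
      refine Or.inr (Or.inr (Or.inr (Or.inr (h.represented hL isAngleCurve_circular
        (ps := fun _ => 0) (lams := 1) (s₀ := 0) (fun s => hasDerivAt_const s 1)
        (fun s => (hasDerivAt_const s (0 : ℝ)).congr_deriv (by norm_num)) hpos hε ?_ ?_ ?_))))
      · linear_combination -hk2 - k 0 ^ 2 * hε
      · linear_combination -k 0 * hε
      · rw [hp0, mul_zero]
  · obtain ⟨r, hr, s, hlam, hk, hp⟩ := exists_borderline_match hpos hE
    refine Or.inr (Or.inr (Or.inl (h.represented hL isAngleCurve_borderline
      (ps := fun s => -2 * sech s * Real.tanh s) (lams := 2)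
      (fun s => ((hasDerivAt_sech s).const_mul 2).congr_deriv (by ring))
      (fun s => (((hasDerivAt_sech s).const_mul (-2)).mul
        (hasDerivAt_tanh_sech s)).congr_deriv ?_) hr hε hlam
      (by rw [hback hk]; ring) (by rw [hback hp]; ring))))
    linear_combination 2 * sech s * sech_sq s

end Elastica

theorem theorem2p11 :
    -- every arclength parametrized planar elastica is one of the five curves
    (∀ (L : ℝ) (γ : ℝ → EuclideanSpace ℝ (Fin 2)), 0 < L →
      Elastica.IsElastica 0 L γ →
      Elastica.IsArclengthParametrized (Set.Icc 0 L) γ →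
        Elastica.RepresentedUpToSimilarity L γ Elastica.linearCurve ∨
        (∃ m ∈ Set.Ioo (0 : ℝ) 1,
          Elastica.RepresentedUpToSimilarity L γ (Elastica.wavelikeCurve m)) ∨
        Elastica.RepresentedUpToSimilarity L γ Elastica.borderlineCurve ∨
        (∃ m ∈ Set.Ioo (0 : ℝ) 1,
          Elastica.RepresentedUpToSimilarity L γ (Elastica.orbitlikeCurve m)) ∨
        Elastica.RepresentedUpToSimilarity L γ Elastica.circularCurve) ∧
    -- the five curves are parametrized by arclength, with these tangential angles and curvatures
    Elastica.IsArclengthCurveWith Elastica.linearCurve (fun _ => 0) (fun _ => 0) ∧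
    (∀ m ∈ Set.Ioo (0 : ℝ) 1, Elastica.IsArclengthCurveWith (Elastica.wavelikeCurve m)
      (fun s => 2 * Real.arcsin (Real.sqrt m * Elastica.sn s m))
      (fun s => 2 * Real.sqrt m * Elastica.cn s m)) ∧
    Elastica.IsArclengthCurveWith Elastica.borderlineCurve
      (fun s => 2 * Real.arcsin (Real.tanh s))
      (fun s => 2 * Elastica.sech s) ∧
    (∀ m ∈ Set.Ioo (0 : ℝ) 1, Elastica.IsArclengthCurveWith (Elastica.orbitlikeCurve m)
      (fun s => 2 * Elastica.am s m)
      (fun s => 2 * Elastica.dn s m)) ∧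
    Elastica.IsArclengthCurveWith Elastica.circularCurve (fun s => s) (fun _ => 1) := by
  refine ⟨fun L γ hL he h => ?_, Elastica.isAngleCurve_linear.isArclengthCurveWith contDiff_const,
    fun m hm => (Elastica.isAngleCurve_wavelike hm.1.le hm.2).isArclengthCurveWith
      (contDiff_const.mul (Elastica.contDiff_cn hm.1.le hm.2)),
    Elastica.isAngleCurve_borderline.isArclengthCurveWith
      (contDiff_const.mul Elastica.contDiff_sech),
    fun m hm => (Elastica.isAngleCurve_orbitlike hm.1 hm.2).isArclengthCurveWith
      (contDiff_const.mul (Elastica.contDiff_dn hm.1.le hm.2)),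
    Elastica.isAngleCurve_circular.isArclengthCurveWith contDiff_const⟩
  obtain ⟨lam, hlam⟩ := he
  obtain ⟨u, v, k, p, hf⟩ := Elastica.exists_isFramedElastica hL hlam h
  exact hf.classification hL
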